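/- Let $k\ge 1$ and $d\ge 2$ be integers. In the online vertex-weighted $b$-matching problem with variable server capacities, a finite nonempty set $S$ of servers is known in advance, where $s\in S$ has a capacity $b_s\in\{1,2,\dots\}$ and a weight $w_s\ge 0$. Requests arrive one by one; on arrival a request reveals its set of neighboring servers and must be immediately and irrevocably either matched to one neighbor or left unmatched, where every server $s$ may be matched to at most $b_s$ requests. An edge matched at $s$ has value $w_s$, and the goal is to maximize the total value. The input graph is a $(k,d)$-graph if every server $s$ has degree at least $k\,b_s$ and every request has degree at most $d$. An algorithm is $c$-competitive if on every $(k,d)$-graph, for every order of arrival, the value of its matching is at least $c$ times the maximum value of a $b$-matching of the graph. For an integer $b\ge 1$ put $$c^*(b)=1-\frac1b\left(\sum_{i=1}^{b} i\binom{kb}{b-i}\frac{1}{(d-1)^{b-i}}\right)\left(1-\frac1d\right)^{kb},$$ and write $c^*_s=c^*(b_s)$. For a server $s$ let $V_s(l,\delta)$ ($0\le l\le b_s$, $\delta\ge l$) be given by $V_s(l,\delta)=1$ if $l=b_s$ or $\delta\ge k b_s$, and by $$b_s\Big(V_s(l+1,\delta+1)-V_s(l,\delta)+(d-1)\big(V_s(l,\delta+1)-V_s(l,\delta)\big)\Big)=\frac1{c^*_s}\qquad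 (l<b_s,\ \delta<k b_s).$$ The algorithm WeightedAssignment(VW) leaves an arriving request unmatched if it has no neighbor with remaining capacity, and otherwise matches it to a neighbor $s$ with remaining capacity that maximizes $w_s\, b_s\,\big(V_s(l_s,\delta_s+1)-V_s(l_s,\delta_s)\big)$, where $l_s$ is the number of requests matched to $s$ so far and $\delta_s$ is the number of previous requests adjacent to $s$; ties are broken arbitrarily. **Theorem.** 1. WeightedAssignment(VW) is a well-defined deterministic online algorithm and, for every rule for breaking ties, it is $\min_{s\in S}c^*_s$-competitive. 2. If $k\ge d$, then $\min_{s\in S}c^*_s=c^*_{\min}$, where $c^*_{\min}:=c^*(\min_{s\in S}b_s)$. 3. If $k\ge d$, this ratio is optimal: for every finite nonempty set $T$ of pairs (capacity, weight) with positive weights, if a deterministic online algorithm is $c$-competitive on all server sets $S$ with $\{(b_s,w_s): s\in S\}=T$, then $c\le c^*(\min\{b:(b,w)\in T\})$. -/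

import Mathlib

/-!
Online vertex-weighted `b`-matching. `S` is the finite set of servers, `b s` the capacity and `w s`
the weight of server `s`; these are known in advance. A request is given by the set of servers it is
adjacent to, and an input is the list of requests in order of arrival. Such a list is the same thing
as a bipartite graph on servers and requests together with an order on the requests.
-/

namespace OnlineBMatching

section Basic

variable {S : Type*} [Fintype S] [DecidableEq S]

/-- The degree of server `s` in the graph formed by the requests in `σ`. -/
def degree (σ : List (Finset S)) (s : S) : ℕ :=
  σ.countP (fun r => decide (s ∈ r))

/-- `(k,d)`-graphs: every server `s` has degree at least `k * b s`, and every request has degree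
at most `d`. -/
def IsKDGraph (k d : ℕ) (b : S → ℕ) (σ : List (Finset S)) : Prop :=
  (∀ s, k * b s ≤ degree σ s) ∧ ∀ r ∈ σ, r.card ≤ d

/-- The load of server `s`: the number of requests assigned to `s`. -/
def load {n : ℕ} (m : Fin n → Option S) (s : S) : ℕ :=
  (Finset.univ.filter (fun i => m i = some s)).card

/-- `m`, which assigns each request to at most one server (`none`: unmatched), is a `b`-matching:
requests are assigned along edges, and no server exceeds its capacity. -/
def IsBMatching (b : S → ℕ) (σ : List (Finset S)) (m : Fin σ.length → Option S) : Prop :=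
  (∀ i s, m i = some s → s ∈ σ.get i) ∧ ∀ s, load m s ≤ b s

/-- The weight of a matching: an edge incident to `s` is worth `w s`. -/
def value (w : S → ℝ) {n : ℕ} (m : Fin n → Option S) : ℝ :=
  ∑ i, (m i).elim 0 w

/-- The maximum weight of a `b`-matching in the graph `σ` (a maximum over a nonempty finite set,
see `isGreatest_opt`). -/
noncomputable def opt (b : S → ℕ) (w : S → ℝ) (σ : List (Finset S)) : ℝ :=
  sSup {x : ℝ | ∃ m : Fin σ.length → Option S, IsBMatching b σ m ∧ value w m = x}

theorem isGreatest_opt (b : S → ℕ) (w : S → ℝ) (σ : List (Finset S)) :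
    IsGreatest {x : ℝ | ∃ m : Fin σ.length → Option S, IsBMatching b σ m ∧ value w m = x}
      (opt b w σ) := by
  have hfin : {x : ℝ | ∃ m : Fin σ.length → Option S, IsBMatching b σ m ∧ value w m = x}.Finite :=
    (Set.toFinite {m : Fin σ.length → Option S | IsBMatching b σ m}).image (value w)
  have hne : {x : ℝ | ∃ m : Fin σ.length → Option S,
      IsBMatching b σ m ∧ value w m = x}.Nonempty :=
    ⟨_, fun _ => none, ⟨by simp, by simp [load]⟩, rfl⟩
  exact ⟨hne.csSup_mem hfin, fun x hx => le_csSup hfin.bddAbove hx⟩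

/-- The assignment produced by an online rule: `assign past r` is the decision for the request `r`
arriving after the requests `past`. Earlier decisions of a deterministic rule are determined by
`past`, so they need not be passed to it. -/
def run (assign : List (Finset S) → Finset S → Option S) (σ : List (Finset S)) :
    Fin σ.length → Option S :=
  fun i => assign (σ.take i) (σ.get i)

/-- A deterministic online algorithm for the servers `S` with capacities `b`. It may leave a request
unmatched. -/
structure OnlineAlgorithm (b : S → ℕ) where
  assign : List (Finset S) → Finset S → Option S
  isBMatching_run : ∀ σ : List (Finset S), IsBMatching b σ (run assign σ)

/-- `A` is `c`-competitive on `(k,d)`-graphs. -/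
def IsCompetitive (k d : ℕ) {b : S → ℕ} (w : S → ℝ) (A : OnlineAlgorithm b) (c : ℝ) : Prop :=
  ∀ σ : List (Finset S), IsKDGraph k d b σ → c * opt b w σ ≤ value w (run A.assign σ)

end Basic

/-- The constant `c*` for capacity `b`. -/
noncomputable def cStar (k d b : ℕ) : ℝ :=
  1 - 1 / (b : ℝ) *
    (∑ i ∈ Finset.Icc 1 b,
      (i : ℝ) * ((k * b).choose (b - i) : ℝ) * (1 / ((d : ℝ) - 1) ^ (b - i))) *
    (1 - 1 / (d : ℝ)) ^ (k * b)

/-- The function `V(l, δ)` for a server of capacity `b`: it is `1` if `l = b` or `δ ≥ k b`, and in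
the remaining cases it is determined by
`V(l+1,δ+1) - V(l,δ) + (d-1) (V(l,δ+1) - V(l,δ)) = 1 / (b c*)`, see `V_eq`. -/
noncomputable def V (k d b l δ : ℕ) : ℝ :=
  if b ≤ l ∨ k * b ≤ δ then 1
  else (V k d b (l + 1) (δ + 1) + ((d : ℝ) - 1) * V k d b l (δ + 1)
    - 1 / ((b : ℝ) * cStar k d b)) / (d : ℝ)
termination_by k * b - δ
decreasing_by all_goals omega

theorem V_full (k d b l δ : ℕ) (h : b ≤ l) : V k d b l δ = 1 := by
  rw [V, if_pos (Or.inl h)]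

theorem V_of_degree (k d b l δ : ℕ) (h : k * b ≤ δ) : V k d b l δ = 1 := by
  rw [V, if_pos (Or.inr h)]

theorem V_eq (k d b l δ : ℕ) (hd : 2 ≤ d) (hl : l < b) (hδ : δ < k * b) :
    V k d b (l + 1) (δ + 1) - V k d b l δ + ((d : ℝ) - 1) * (V k d b l (δ + 1) - V k d b l δ)
      = 1 / ((b : ℝ) * cStar k d b) := by
  have hd' : (d : ℝ) ≠ 0 := by
    have : d ≠ 0 := by omega
    exact_mod_cast this
  have h : V k d b l δ = (V k d b (l + 1) (δ + 1) + ((d : ℝ) - 1) * V k d b l (δ + 1)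
      - 1 / ((b : ℝ) * cStar k d b)) / (d : ℝ) := by
    rw [V, if_neg (by omega)]
  rw [eq_div_iff hd'] at h
  linarith

section Algorithm

variable {S : Type*} [Fintype S] [DecidableEq S]

/-- The quantity `w_s b_s (V_s(l_s, δ_s + 1) - V_s(l_s, δ_s))` when the algorithm `A` has processed
the requests `past`; `l_s` and `δ_s` are the load and degree of `s` at that time. -/
noncomputable def priority (k d : ℕ) {b : S → ℕ} (w : S → ℝ) (A : OnlineAlgorithm b)
    (past : List (Finset S)) (s : S) : ℝ :=
  w s * (b s : ℝ) *
    (V k d (b s) (load (run A.assign past) s) (degree past s + 1)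
      - V k d (b s) (load (run A.assign past) s) (degree past s))

/-- The neighbours of the request `r` with remaining capacity when `A` has processed `past`. -/
def available {b : S → ℕ} (A : OnlineAlgorithm b) (past : List (Finset S)) (r : Finset S) :
    Finset S :=
  r.filter (fun s => load (run A.assign past) s < b s)

/-- `A` is the algorithm WeightedAssignment(VW), with some rule for breaking ties: a request without
available neighbour stays unmatched, any other request is assigned to an available neighbour of
maximum priority. -/
def IsWeightedAssignmentVW (k d : ℕ) {b : S → ℕ} (w : S → ℝ) (A : OnlineAlgorithm b) : Prop :=
  ∀ (past : List (Finset S)) (r : Finset S),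
    (available A past r = ∅ → A.assign past r = none) ∧
    ((available A past r).Nonempty →
      ∃ s ∈ available A past r, A.assign past r = some s ∧
        ∀ s' ∈ available A past r, priority k d w A past s' ≤ priority k d w A past s)

end Algorithm

end OnlineBMatching

/-!
Let `X` be the number of successes in `k b` independent trials of probability `1 / d`. Then
`b c* = E[min(b, X)]`, and `V` is the normalised decrease of the conditional expectation of
`min(b, X)`: `b c* (1 - V(l, δ)) = E[min(b, l + Y)] - l` with `Y` counting the successes in
`k b - δ` trials. Two consequences: `V` is nondecreasing in `δ`, and `c*` is nondecreasing in `b`,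
since `E[min(n / k, X_n)] / n` is nondecreasing in the number of trials `n` by exchangeability.

Competitiveness: the potential `∑ w_s b_s V_s(l_s, δ_s)` starts at `0` and ends at `∑ w_s b_s ≥ opt`
on a `(k,d)`-graph. When `s` is matched, the recursion for `V_s` says that the gain of `s` together
with `d - 1` times its priority is at most `w_s / c*_s`, and the priorities of the at most `d - 1`
other neighbours, which are their gains, are bounded by that of `s`. So the value of the matching is
at least `min_s c*_s` times the final potential.

Optimality: against `d ^ (k b)` servers of capacity `b`, an adversary partitions the servers into
requests of size `d`, of which only a fraction `1 / d` can be matched, and repeats this separately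
on the matched and the unmatched servers. After `k b` rounds the mean load is at most
`E[min(b, X)] = b c*`, although for `k ≥ d` Hall's theorem provides a matching saturating all
servers. With many copies of a server the other servers do not matter.
-/

namespace OnlineBMatching

open MeasureTheory ProbabilityTheory

section Binomial

variable {E : Type*} [NormedAddCommGroup E] [NormedSpace ℝ E] [CompleteSpace E]
  (p : unitInterval)

theorem integral_binomial_eq_sum_antidiagonal (n : ℕ) (f : ℕ → E) :
    ∫ x, f x ∂Bin(n, p) = ∑ ij ∈ Finset.HasAntidiagonal.antidiagonal n,
      n.choose ij.1 • ((p : ℝ) ^ ij.1 * (1 - p) ^ ij.2) • f ij.1 := by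
  rw [integral_binomial, ← Nat.range_succ_eq_Iic,
    Finset.Nat.sum_antidiagonal_eq_sum_range_succ
      (fun i j => n.choose i • ((p : ℝ) ^ i * (1 - p) ^ j) • f i)]
  simp only [← Nat.cast_smul_eq_nsmul ℝ, smul_smul, mul_assoc]

theorem integral_binomial_succ (n : ℕ) (f : ℕ → E) :
    ∫ x, f x ∂Bin(n + 1, p)
      = (p : ℝ) • ∫ x, f (x + 1) ∂Bin(n, p) + (1 - p : ℝ) • ∫ x, f x ∂Bin(n, p) := by
  simp only [integral_binomial_eq_sum_antidiagonal, Finset.smul_sum]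
  rw [Finset.sum_antidiagonal_choose_succ_nsmul (fun i j => ((p : ℝ) ^ i * (1 - p) ^ j) • f i),
    add_comm]
  congr 1 <;> refine Finset.sum_congr rfl fun ij hij => ?_
  · rw [Nat.choose_symm_of_eq_add (Finset.HasAntidiagonal.mem_antidiagonal.1 hij).symm,
      smul_comm (p : ℝ), smul_smul]
    ring_nf
  · rw [smul_comm (1 - p : ℝ), smul_smul]
    ring_nf

theorem integral_binomial_add (m n : ℕ) (f : ℕ → E) :
    ∫ x, f x ∂Bin(m + n, p) = ∫ a, ∫ x, f (a + x) ∂Bin(n, p) ∂Bin(m, p) := by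
  induction m generalizing f with
  | zero => simp [binomial_zero]
  | succ m ih => simp only [Nat.add_right_comm, integral_binomial_succ, ih]

theorem integral_binomial_mono (n : ℕ) {f g : ℕ → ℝ} (h : ∀ i, f i ≤ g i) :
    ∫ x, f x ∂Bin(n, p) ≤ ∫ x, g x ∂Bin(n, p) :=
  integral_mono (integrable_binomial f) (integrable_binomial g) h

theorem monotone_integral_binomial {f : ℕ → ℝ} (hf : Monotone f) :
    Monotone fun n => ∫ x, f x ∂Bin(n, p) := by
  refine monotone_nat_of_le_succ fun n => ?_
  have hshift := mul_le_mul_of_nonneg_left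
    (integral_binomial_mono p n fun i => hf i.le_succ) p.2.1
  simp only [integral_binomial_succ, smul_eq_mul]
  linarith

theorem integral_binomial_succ_natCast_mul (n : ℕ) (f : ℕ → ℝ) :
    ∫ x, x * f x ∂Bin(n + 1, p) = (n + 1) * p * ∫ x, f (x + 1) ∂Bin(n, p) := by
  induction n generalizing f with
  | zero =>
    rw [integral_binomial_succ]
    simp [binomial_zero]
  | succ n ih =>
    have hshift : ∫ x : ℕ, ((x + 1 : ℕ) : ℝ) * f (x + 1) ∂Bin(n + 1, p)
        = (n + 1) * p * ∫ x, f (x + 1 + 1) ∂Bin(n, p) + ∫ x, f (x + 1) ∂Bin(n + 1, p) := by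
      simp only [Nat.cast_succ, add_one_mul]
      rw [integral_add (integrable_binomial _) (integrable_binomial _), ih fun i => f (i + 1)]
      ring
    rw [integral_binomial_succ, hshift, ih f, integral_binomial_succ p n fun i => f (i + 1)]
    simp only [smul_eq_mul]
    push_cast
    ring

/-- By exchangeability, the last `n` of `m + n` trials contribute a fraction `n / (m + n)` of the
successes. -/
theorem mul_integral_binomial_natCast_mul (m n : ℕ) (f : ℕ → ℝ) :
    (m + n) * ∫ a, ∫ x, x * f (a + x) ∂Bin(n, p) ∂Bin(m, p)
      = n * ∫ x, x * f x ∂Bin(m + n, p) := by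
  cases n with
  | zero => simp [binomial_zero]
  | succ n =>
    simp only [← add_assoc, integral_binomial_succ_natCast_mul p _ fun i => f (_ + i),
      integral_binomial_succ_natCast_mul p _ f, integral_const_mul,
      integral_binomial_add p m n fun i => f (i + 1)]
    push_cast
    ring

/-- `min (c * m) X / m` has the larger mean the more trials there are: for both numbers of trials
the choice between the two terms is made by the outcome of all `m` trials, which is optimal for `m`
trials and an upper bound for the first `n`, and exchangeability makes the two bounds agree. -/
theorem mul_integral_binomial_min_le {m n : ℕ} (h : n ≤ m) (c : ℝ) :
    m * ∫ x, min (c * n) (x : ℝ) ∂Bin(n, p) ≤ n * ∫ x, min (c * m) (x : ℝ) ∂Bin(m, p) := by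
  obtain ⟨m, rfl⟩ := Nat.exists_eq_add_of_le' h
  let below : ℕ → ℝ := fun x => if x < c * (m + n : ℕ) then 1 else 0
  have hlarge : ∫ x, min (c * (m + n : ℕ)) (x : ℝ) ∂Bin(m + n, p) = c * (m + n : ℕ)
      + ∫ x, x * below x ∂Bin(m + n, p) - c * (m + n : ℕ) * ∫ x, below x ∂Bin(m + n, p) := by
    have hmin (x : ℕ) : min (c * (m + n : ℕ)) (x : ℝ)
        = c * (m + n : ℕ) + x * below x - c * (m + n : ℕ) * below x := by
      simp only [below]
      split_ifs with hx
      · rw [min_eq_right hx.le]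
        ring
      · rw [min_eq_left (not_lt.1 hx)]
        ring
    simp only [hmin, integral_sub, integral_add, integrable_binomial, integral_const_mul]
    simp
  have hsmall : ∫ x, min (c * n) (x : ℝ) ∂Bin(n, p) ≤ c * n
      + ∫ a, ∫ x, x * below (a + x) ∂Bin(n, p) ∂Bin(m, p)
      - c * n * ∫ x, below x ∂Bin(m + n, p) := by
    have hmin (a x : ℕ) : min (c * n) (x : ℝ)
        ≤ c * n + x * below (a + x) - c * n * below (a + x) := by
      simp only [below]
      split_ifs
      · linarith [min_le_right (c * n) (x : ℝ)]
      · linarith [min_le_left (c * n) (x : ℝ)]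
    calc ∫ x, min (c * n) (x : ℝ) ∂Bin(n, p)
      _ = ∫ _, ∫ x, min (c * n) (x : ℝ) ∂Bin(n, p) ∂Bin(m, p) := by simp
      _ ≤ ∫ a, ∫ x, c * n + x * below (a + x) - c * n * below (a + x) ∂Bin(n, p) ∂Bin(m, p) :=
        integral_binomial_mono p m fun a => integral_binomial_mono p n (hmin a)
      _ = _ := by
        simp only [integral_sub, integral_add, integrable_binomial, integral_const_mul,
          integral_binomial_add p m n below]
        simp
  have hexch := mul_integral_binomial_natCast_mul p m n below
  rw [hlarge]
  push_cast
  linarith [mul_le_mul_of_nonneg_left hsmall (by positivity : (0 : ℝ) ≤ m + n)]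

end Binomial

section Constant

variable {k d b b' : ℕ}

/-- The probability `1 / d` that a uniformly random one of `d` neighbours is a given one. -/
noncomputable def uniformProb (d : ℕ) : unitInterval :=
  ⟨1 / d, by positivity, by simpa only [one_div] using Nat.cast_inv_le_one d⟩

theorem coe_uniformProb (d : ℕ) : (uniformProb d : ℝ) = 1 / d := rfl

theorem mul_one_sub_cStar (k b : ℕ) (hd : 2 ≤ d) :
    b * (1 - cStar k d b) = ∫ x, ((b - x : ℕ) : ℝ) ∂Bin(k * b, uniformProb d) := by
  have hd' : (0 : ℝ) < d - 1 := by
    have : (2 : ℝ) ≤ d := by exact_mod_cast hd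
    linarith
  have hcompl : 1 - 1 / (d : ℝ) = (d - 1) * (1 / d) := by field_simp
  have hprob {x : ℕ} (hx : x ≤ k * b) :
      (1 / (d : ℝ)) ^ x * (1 - 1 / d) ^ (k * b - x)
        = 1 / ((d : ℝ) - 1) ^ x * (1 - 1 / d) ^ (k * b) := by
    rw [hcompl, ← pow_mul_pow_sub _ hx, mul_pow _ _ x]
    field_simp
  calc b * (1 - cStar k d b)
    _ = ∑ i ∈ Finset.Ico 1 (b + 1), (i : ℝ) * (k * b).choose (b - i)
          * (1 / ((d : ℝ) - 1) ^ (b - i)) * (1 - 1 / d) ^ (k * b) := by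
      rw [cStar, sub_sub_cancel, ← Finset.sum_mul]
      rcases eq_or_ne b 0 with rfl | hb
      · simp
      · field_simp
        rfl
    _ = ∑ x ∈ Finset.range b, ((b - x : ℕ) : ℝ) * (k * b).choose x
          * (1 / ((d : ℝ) - 1) ^ x) * (1 - 1 / d) ^ (k * b) := by
      refine Finset.sum_nbij' (b - ·) (b - ·) ?_ ?_ ?_ ?_ ?_ <;>
        simp only [Finset.mem_Ico, Finset.mem_range] <;> intro i hi
      all_goals try omega
      rw [Nat.sub_sub_self (by omega)]
    _ = ∫ x, ((b - x : ℕ) : ℝ) ∂Bin(k * b, uniformProb d) := by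
      rw [integral_binomial]
      refine Finset.sum_congr_of_eq_on_inter (fun x _ hx => ?_) (fun x _ hx => ?_)
        fun x _ hx => ?_
      · simp [Nat.choose_eq_zero_of_lt (not_le.1 fun h => hx (Finset.mem_Iic.2 h))]
      · simp [Nat.sub_eq_zero_of_le (not_lt.1 fun h => hx (Finset.mem_range.2 h))]
      · rw [mul_assoc _ (1 / _), ← hprob (Finset.mem_Iic.1 hx), coe_uniformProb, smul_eq_mul]
        ring

theorem mul_cStar (k b : ℕ) (hd : 2 ≤ d) :
    b * cStar k d b = ∫ x, min (b : ℝ) x ∂Bin(k * b, uniformProb d) := by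
  have hmin (x : ℕ) : min (b : ℝ) x = b - ((b - x : ℕ) : ℝ) := by
    rw [eq_sub_iff_add_eq, ← Nat.cast_min, ← Nat.cast_add]
    congr 1
    omega
  simp only [hmin]
  rw [integral_sub (integrable_binomial _) (integrable_binomial _), ← mul_one_sub_cStar k b hd,
    integral_const, probReal_univ, one_smul]
  ring

theorem cStar_mono (hk : 1 ≤ k) (hd : 2 ≤ d) (hb : 1 ≤ b) (h : b ≤ b') :
    cStar k d b ≤ cStar k d b' := by
  have hk0 : (0 : ℝ) < k := by exact_mod_cast hk
  have hb0 : (0 : ℝ) < b * b' := by exact_mod_cast Nat.mul_pos hb (hb.trans h)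
  have hmean := mul_integral_binomial_min_le (uniformProb d) (Nat.mul_le_mul_left k h) (1 / k)
  push_cast at hmean
  simp only [one_div, inv_mul_cancel_left₀ hk0.ne', ← mul_cStar k _ hd] at hmean
  refine le_of_mul_le_mul_left ?_ (mul_pos hk0 hb0)
  linarith

theorem cStar_pos (hk : 1 ≤ k) (hd : 2 ≤ d) (hb : 1 ≤ b) : 0 < cStar k d b := by
  have hd' : (1 : ℝ) < d := by exact_mod_cast hd
  calc 0
    _ < 1 - (1 - 1 / (d : ℝ)) ^ k :=
      sub_pos.2 (pow_lt_one₀ (sub_nonneg.2 (div_le_one_of_le₀ hd'.le (by positivity)))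
        (sub_lt_self _ (by positivity)) (by omega))
    _ = cStar k d 1 := by simp [cStar]
    _ ≤ cStar k d b := cStar_mono hk hd le_rfl hb

theorem inf'_cStar (hk : 1 ≤ k) (hd : 2 ≤ d) {ι : Type*} {s : Finset ι} (hs : s.Nonempty)
    {b : ι → ℕ} (hb : ∀ i ∈ s, 1 ≤ b i) :
    s.inf' hs (fun i => cStar k d (b i)) = cStar k d (s.inf' hs b) := by
  apply le_antisymm
  · obtain ⟨i, hi, hmin⟩ := s.exists_mem_eq_inf' hs b
    rw [hmin]
    exact Finset.inf'_le (fun i => cStar k d (b i)) hi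
  · exact Finset.le_inf' _ _ fun i hi =>
      cStar_mono hk hd (Finset.le_inf' _ _ hb) (Finset.inf'_le b hi)

end Constant

section Potential

variable {k d b l : ℕ}

theorem mul_one_sub_V (hd : 2 ≤ d) (hl : l ≤ b) (δ : ℕ) :
    b * cStar k d b * (1 - V k d b l δ)
      = ∫ x, min (b : ℝ) (l + x) ∂Bin(k * b - δ, uniformProb d) - l := by
  induction hj : k * b - δ generalizing l δ with
  | zero =>
    rw [V_of_degree k d b l δ (by omega)]
    simp [binomial_zero, hl]
  | succ j ih =>
    rcases hl.eq_or_lt with rfl | hl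
    · rw [V_full _ _ _ _ _ le_rfl]
      simp
    · have hkb : 0 < k * b := by omega
      have hc : 0 < b * cStar k d b := mul_pos (by exact_mod_cast l.zero_le.trans_lt hl)
        (cStar_pos (Nat.pos_of_mul_pos_right hkb) hd (by omega))
      have hrec := V_eq k d b l δ hd hl (by omega)
      have htaken := ih (l := l + 1) hl (δ + 1) (by omega)
      have hskipped := ih hl.le (δ + 1) (by omega)
      rw [eq_div_iff hc.ne'] at hrec
      rw [integral_binomial_succ, coe_uniformProb, smul_eq_mul, smul_eq_mul]
      push_cast at htaken ⊢
      simp only [add_assoc, add_comm (1 : ℝ)] at htaken ⊢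
      field_simp
      linear_combination htaken + (d - 1) * hskipped + hrec

theorem V_zero_zero (hk : 1 ≤ k) (hd : 2 ≤ d) (hb : 1 ≤ b) : V k d b 0 0 = 0 := by
  have hc : 0 < b * cStar k d b := mul_pos (by exact_mod_cast hb) (cStar_pos hk hd hb)
  have h := mul_one_sub_V (k := k) hd b.zero_le 0
  simp only [Nat.cast_zero, zero_add, sub_zero, Nat.sub_zero, ← mul_cStar k b hd] at h
  linarith [(mul_eq_left₀ hc.ne').1 h]

theorem V_le_succ (hd : 2 ≤ d) (l δ : ℕ) : V k d b l δ ≤ V k d b l (δ + 1) := by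
  rcases le_or_gt b l with hl | hl
  · rw [V_full _ _ _ _ _ hl, V_full _ _ _ _ _ hl]
  rcases le_or_gt (k * b) δ with hδ | hδ
  · rw [V_of_degree _ _ _ _ _ hδ, V_of_degree _ _ _ _ _ (by omega)]
  have hc : 0 < b * cStar k d b := mul_pos (by exact_mod_cast l.zero_le.trans_lt hl)
    (cStar_pos (Nat.pos_of_mul_pos_right (δ.zero_le.trans_lt hδ)) hd (by omega))
  have hmono : Monotone fun x : ℕ => min (b : ℝ) (l + x) := fun x y hxy => by
    dsimp only
    gcongr
  have hint : ∫ x, min (b : ℝ) (l + x) ∂Bin(k * b - (δ + 1), uniformProb d)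
      ≤ ∫ x, min (b : ℝ) (l + x) ∂Bin(k * b - δ, uniformProb d) :=
    monotone_integral_binomial _ hmono (by omega)
  have hdecr := sub_le_sub_right hint (l : ℝ)
  rw [← mul_one_sub_V hd hl.le, ← mul_one_sub_V hd hl.le] at hdecr
  linarith [le_of_mul_le_mul_left hdecr hc]

end Potential

section Run

variable {S : Type*}

theorem sum_run_concat {M : Type*} [AddCommMonoid M]
    (assign : List (Finset S) → Finset S → Option S) (g : Option S → M)
    (σ : List (Finset S)) (r : Finset S) :
    ∑ i, g (run assign (σ ++ [r]) i) = ∑ i, g (run assign σ i) + g (assign σ r) := by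
  have hlen : (σ ++ [r]).length = σ.length + 1 := by simp
  rw [← (finCongr hlen.symm).sum_comp, Fin.sum_univ_castSucc]
  congr 1
  · refine Finset.sum_congr rfl fun i _ => ?_
    simp [run, List.take_append_of_le_length i.2.le, List.getElem_append_left i.2]
  · simp [run]

theorem value_run_concat (assign : List (Finset S) → Finset S → Option S) (w : S → ℝ)
    (σ : List (Finset S)) (r : Finset S) :
    value w (run assign (σ ++ [r])) = value w (run assign σ) + (assign σ r).elim 0 w :=
  sum_run_concat assign (fun o => o.elim 0 w) σ r

variable [DecidableEq S]

theorem load_run_nil (assign : List (Finset S) → Finset S → Option S) (s : S) :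
    load (run assign []) s = 0 := by
  simp [load]

theorem load_run_concat (assign : List (Finset S) → Finset S → Option S)
    (σ : List (Finset S)) (r : Finset S) (s : S) :
    load (run assign (σ ++ [r])) s
      = load (run assign σ) s + if assign σ r = some s then 1 else 0 := by
  simp only [load, Finset.card_filter]
  exact sum_run_concat assign (fun o => if o = some s then 1 else 0) σ r

theorem value_eq_sum_load [Fintype S] (w : S → ℝ) {n : ℕ} (m : Fin n → Option S) :
    value w m = ∑ s, w s * load m s := by
  simp only [value, load, Finset.card_filter, Nat.cast_sum, Finset.mul_sum]
  rw [Finset.sum_comm]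
  refine Finset.sum_congr rfl fun i _ => ?_
  cases m i <;> simp

theorem degree_nil (s : S) : degree [] s = 0 := rfl

theorem degree_append (σ τ : List (Finset S)) (s : S) :
    degree (σ ++ τ) s = degree σ s + degree τ s :=
  List.countP_append

theorem degree_singleton (r : Finset S) (s : S) : degree [r] s = if s ∈ r then 1 else 0 := by
  simp [degree, List.countP_singleton]

theorem degree_eq_zero_iff {σ : List (Finset S)} {s : S} : degree σ s = 0 ↔ ∀ r ∈ σ, s ∉ r := by
  simp [degree, List.countP_eq_zero]

theorem degree_eq_card (σ : List (Finset S)) (s : S) :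
    degree σ s = (Finset.univ.filter fun i => s ∈ σ.get i).card := by
  induction σ with
  | nil => simp [degree_nil]
  | cons r σ ih =>
    rw [← List.singleton_append, degree_append, degree_singleton, ih, Finset.card_filter,
      Finset.card_filter]
    exact (Fin.sum_univ_succ fun i => if s ∈ (r :: σ).get i then 1 else 0).symm

namespace OnlineAlgorithm

variable {b : S → ℕ} (A : OnlineAlgorithm b) {σ : List (Finset S)} {r : Finset S} {s : S}

theorem mem_of_assign_eq_some (h : A.assign σ r = some s) : s ∈ r := by
  have hmem := (A.isBMatching_run (σ ++ [r])).1 ⟨σ.length, by simp⟩ s (by simpa [run] using h)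
  simpa using hmem

theorem load_le (σ : List (Finset S)) (s : S) : load (run A.assign σ) s ≤ b s :=
  (A.isBMatching_run σ).2 s

theorem load_lt_of_assign_eq_some (h : A.assign σ r = some s) : load (run A.assign σ) s < b s := by
  have hload := A.load_le (σ ++ [r]) s
  rw [load_run_concat, if_pos h] at hload
  exact hload

theorem load_append_le (σ τ : List (Finset S)) (s : S) :
    load (run A.assign (σ ++ τ)) s ≤ load (run A.assign σ) s + degree τ s := by
  induction τ using List.reverseRecOn with
  | nil => rw [List.append_nil, degree_nil, add_zero]
  | append_singleton τ r ih =>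
    rw [← List.append_assoc, load_run_concat, degree_append, degree_singleton]
    split_ifs with hassign hmem
    · omega
    · exact absurd (A.mem_of_assign_eq_some hassign) hmem
    all_goals omega

end OnlineAlgorithm

/-- The loads of the servers after the requests `σ`, if a request `r` arriving after the requests
`past` when the loads are `L` is assigned to `pick past L r`. -/
def loadsOf (pick : List (Finset S) → (S → ℕ) → Finset S → Option S) (σ : List (Finset S)) :
    S → ℕ :=
  σ.reverseRecOn 0 fun past r L s => L s + if pick past L r = some s then 1 else 0

theorem load_run_loadsOf (pick : List (Finset S) → (S → ℕ) → Finset S → Option S)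
    (σ : List (Finset S)) :
    load (run (fun past => pick past (loadsOf pick past)) σ) = loadsOf pick σ := by
  induction σ using List.reverseRecOn with
  | nil => funext s; simp [load_run_nil, loadsOf]
  | append_singleton σ r ih =>
    funext s
    rw [load_run_concat, ih, loadsOf, loadsOf, List.reverseRecOn_concat]

/-- The online algorithm that decides by the past and the current loads, where `pick` respects
adjacency and the remaining capacities. -/
def OnlineAlgorithm.ofLoads {b : S → ℕ} (pick : List (Finset S) → (S → ℕ) → Finset S → Option S)
    (hpick : ∀ σ L r s, pick σ L r = some s → s ∈ r ∧ L s < b s) : OnlineAlgorithm b where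
  assign past := pick past (loadsOf pick past)
  isBMatching_run σ := by
    refine ⟨fun i s hi => (hpick _ _ _ _ hi).1, fun s => ?_⟩
    induction σ using List.reverseRecOn with
    | nil => simp [load_run_nil]
    | append_singleton σ r ih =>
      rw [load_run_concat]
      split_ifs with hassign
      · have hlt := (hpick _ _ _ _ hassign).2
        rwa [← load_run_loadsOf] at hlt
      · exact ih

end Run

section Competitive

variable {S : Type*} [DecidableEq S]

theorem exists_isWeightedAssignmentVW (k d : ℕ) (b : S → ℕ) (w : S → ℝ) :
    ∃ A : OnlineAlgorithm b, IsWeightedAssignmentVW k d w A := by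
  let free (L : S → ℕ) (r : Finset S) : Finset S := r.filter fun s => L s < b s
  let prio (past : List (Finset S)) (L : S → ℕ) (s : S) : ℝ :=
    w s * b s * (V k d (b s) (L s) (degree past s + 1) - V k d (b s) (L s) (degree past s))
  have hdecide (past : List (Finset S)) (L : S → ℕ) (r : Finset S) : ∃ o : Option S,
      (free L r = ∅ → o = none) ∧ ((free L r).Nonempty →
        ∃ s ∈ free L r, o = some s ∧ ∀ s' ∈ free L r, prio past L s' ≤ prio past L s) := by
    rcases (free L r).eq_empty_or_nonempty with hfree | hfree
    · exact ⟨none, fun _ => rfl, fun hne => absurd hfree hne.ne_empty⟩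
    · obtain ⟨s, hs, hmax⟩ := (free L r).exists_max_image (prio past L) hfree
      exact ⟨some s, fun he => absurd he hfree.ne_empty, fun _ => ⟨s, hs, rfl, hmax⟩⟩
  choose pick hnone hsome using hdecide
  refine ⟨OnlineAlgorithm.ofLoads pick fun past L r s hs => ?_, fun past r => ?_⟩
  · rcases (free L r).eq_empty_or_nonempty with hfree | hfree
    · simp [hnone past L r hfree] at hs
    · obtain ⟨s', hs', hpick, -⟩ := hsome past L r hfree
      obtain rfl : s' = s := Option.some_inj.1 (hpick.symm.trans hs)
      exact Finset.mem_filter.1 hs'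
  · simp only [available, priority, OnlineAlgorithm.ofLoads, load_run_loadsOf]
    exact ⟨hnone past _ r, hsome past _ r⟩

variable {k d : ℕ} {b : S → ℕ} {w : S → ℝ} {A : OnlineAlgorithm b}

theorem priority_nonneg (hd : 2 ≤ d) {s : S} (hw : 0 ≤ w s) (past : List (Finset S)) :
    0 ≤ priority k d w A past s :=
  mul_nonneg (mul_nonneg hw (Nat.cast_nonneg _)) (sub_nonneg.2 (V_le_succ hd _ _))

theorem priority_eq_zero {past : List (Finset S)} {s : S} (h : b s ≤ load (run A.assign past) s) :
    priority k d w A past s = 0 := by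
  rw [priority, V_full _ _ _ _ _ h, V_full _ _ _ _ _ h, sub_self, mul_zero]

theorem mem_available_of_assign_eq_some {past : List (Finset S)} {r : Finset S} {s : S}
    (h : A.assign past r = some s) : s ∈ available A past r :=
  Finset.mem_filter.2 ⟨A.mem_of_assign_eq_some h, A.load_lt_of_assign_eq_some h⟩

namespace IsWeightedAssignmentVW

variable {past : List (Finset S)} {r : Finset S} {s s' : S}

theorem priority_eq_zero_of_assign_eq_none (hA : IsWeightedAssignmentVW k d w A)
    (h : A.assign past r = none) (hs : s ∈ r) : priority k d w A past s = 0 := by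
  refine priority_eq_zero (not_lt.1 fun hlt => ?_)
  obtain ⟨s', -, hsome, -⟩ := (hA past r).2 ⟨s, Finset.mem_filter.2 ⟨hs, hlt⟩⟩
  simp [h] at hsome

theorem priority_le_of_assign_eq_some (hA : IsWeightedAssignmentVW k d w A) (hd : 2 ≤ d)
    (hw : 0 ≤ w s) (h : A.assign past r = some s) (hs' : s' ∈ r) :
    priority k d w A past s' ≤ priority k d w A past s := by
  rcases lt_or_ge (load (run A.assign past) s') (b s') with hfree | hfull
  · obtain ⟨t, -, ht, hmax⟩ := (hA past r).2 ⟨s, mem_available_of_assign_eq_some h⟩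
    obtain rfl : s = t := Option.some_inj.1 (h.symm.trans ht)
    exact hmax s' (Finset.mem_filter.2 ⟨hs', hfree⟩)
  · rw [priority_eq_zero hfull]
    exact priority_nonneg hd hw past

theorem sum_erase_priority_le (hA : IsWeightedAssignmentVW k d w A) (hd : 2 ≤ d)
    (hw : 0 ≤ w s) (hr : r.card ≤ d) (h : A.assign past r = some s) :
    ∑ s' ∈ r.erase s, priority k d w A past s' ≤ (d - 1) * priority k d w A past s := by
  have hsr := A.mem_of_assign_eq_some h
  calc ∑ s' ∈ r.erase s, priority k d w A past s'
    _ ≤ (r.erase s).card • priority k d w A past s :=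
      Finset.sum_le_card_nsmul _ _ _ fun s' hs' =>
        hA.priority_le_of_assign_eq_some hd hw h (Finset.mem_of_mem_erase hs')
    _ = (r.card - 1) * priority k d w A past s := by
      rw [nsmul_eq_mul, Finset.cast_card_erase_of_mem hsr]
    _ ≤ (d - 1) * priority k d w A past s := by
      have := priority_nonneg (k := k) (A := A) hd hw past
      gcongr

end IsWeightedAssignmentVW

/-- The contribution `w_s b_s V_s(l_s, δ_s)` of server `s` to the potential after the requests `σ`:
`V_s` interpolates between `0` for an untouched server and `1` for a server that is full or has
received its guaranteed degree `k b_s`. -/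
noncomputable def serverPotential (k d : ℕ) {b : S → ℕ} (w : S → ℝ) (A : OnlineAlgorithm b)
    (σ : List (Finset S)) (s : S) : ℝ :=
  w s * b s * V k d (b s) (load (run A.assign σ) s) (degree σ s)

theorem serverPotential_concat_sub_of_ne {past : List (Finset S)} {r : Finset S} {s : S}
    (h : A.assign past r ≠ some s) :
    serverPotential k d w A (past ++ [r]) s - serverPotential k d w A past s
      = if s ∈ r then priority k d w A past s else 0 := by
  rw [serverPotential, serverPotential, load_run_concat, if_neg h, degree_append,
    degree_singleton, add_zero]
  split_ifs
  · rw [priority, mul_sub]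
  · simp

theorem serverPotential_concat_sub_add_le (hk : 1 ≤ k) (hd : 2 ≤ d) {past : List (Finset S)}
    {r : Finset S} {s : S} (hw : 0 ≤ w s) (h : A.assign past r = some s) :
    serverPotential k d w A (past ++ [r]) s - serverPotential k d w A past s
      + (d - 1) * priority k d w A past s ≤ w s / cStar k d (b s) := by
  have hlt := A.load_lt_of_assign_eq_some h
  have hb : 0 < b s := by omega
  have hc := cStar_pos hk hd hb
  rw [serverPotential, serverPotential, load_run_concat, if_pos h, degree_append,
    degree_singleton, if_pos (A.mem_of_assign_eq_some h), priority]
  rcases le_or_gt (k * b s) (degree past s) with hδ | hδ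
  · rw [V_of_degree _ _ _ _ _ hδ, V_of_degree _ _ _ _ _ (by omega),
      V_of_degree _ _ _ _ _ (by omega)]
    simpa using div_nonneg hw hc.le
  · have hb0 : (b s : ℝ) ≠ 0 := by exact_mod_cast hb.ne'
    have hrate : w s / cStar k d (b s) = w s * b s * (1 / (b s * cStar k d (b s))) := by
      field_simp [hb0]
    rw [hrate, ← V_eq k d (b s) _ _ hd hlt hδ]
    apply le_of_eq
    ring

section Potential

variable [Fintype S]

/-- The potential of the primal-dual analysis of WeightedAssignment(VW), whose increase at each
request is charged to the value of the edge that is matched. -/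
noncomputable def potential (k d : ℕ) {b : S → ℕ} (w : S → ℝ) (A : OnlineAlgorithm b)
    (σ : List (Finset S)) : ℝ :=
  ∑ s, serverPotential k d w A σ s

theorem potential_nil (hk : 1 ≤ k) (hd : 2 ≤ d) (hb : ∀ s, 1 ≤ b s) :
    potential k d w A [] = 0 :=
  Finset.sum_eq_zero fun s _ => by
    rw [serverPotential, load_run_nil, degree_nil, V_zero_zero hk hd (hb s), mul_zero]

/-- The matched server may gain less than its reward `w_s / c*_s`; by maximality of its priority,
what is left pays for the gains of the other neighbours. -/
theorem potential_concat_sub_le (hk : 1 ≤ k) (hd : 2 ≤ d) (hw : ∀ s, 0 ≤ w s)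
    (hA : IsWeightedAssignmentVW k d w A) (past : List (Finset S)) {r : Finset S}
    (hr : r.card ≤ d) :
    potential k d w A (past ++ [r]) - potential k d w A past
      ≤ (A.assign past r).elim 0 fun s => w s / cStar k d (b s) := by
  rw [potential, potential, ← Finset.sum_sub_distrib]
  cases h : A.assign past r with
  | none =>
    refine Finset.sum_nonpos fun s _ => ?_
    rw [serverPotential_concat_sub_of_ne (by simp [h])]
    split_ifs with hs
    · exact (hA.priority_eq_zero_of_assign_eq_none h hs).le
    · exact le_rfl
  | some s =>
    have hothers : ∑ s' ∈ Finset.univ.erase s,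
        (serverPotential k d w A (past ++ [r]) s' - serverPotential k d w A past s')
          = ∑ s' ∈ r.erase s, priority k d w A past s' := by
      rw [← Finset.univ_inter (r.erase s), Finset.inter_erase, ← Finset.erase_inter,
        ← Finset.sum_ite_mem]
      refine Finset.sum_congr rfl fun s' hs' => serverPotential_concat_sub_of_ne fun hs => ?_
      exact Finset.ne_of_mem_erase hs' (Option.some_inj.1 (hs.symm.trans h))
    rw [← Finset.add_sum_erase _ _ (Finset.mem_univ s), hothers, Option.elim_some]
    linarith [serverPotential_concat_sub_add_le hk hd (hw s) h,
      hA.sum_erase_priority_le hd (hw s) hr h]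

theorem mul_potential_le_value (hk : 1 ≤ k) (hd : 2 ≤ d) (hb : ∀ s, 1 ≤ b s)
    (hw : ∀ s, 0 ≤ w s) (hA : IsWeightedAssignmentVW k d w A) {c : ℝ} (hc0 : 0 ≤ c)
    (hc : ∀ s, c ≤ cStar k d (b s)) {σ : List (Finset S)} (hσ : ∀ r ∈ σ, r.card ≤ d) :
    c * potential k d w A σ ≤ value w (run A.assign σ) := by
  induction σ using List.reverseRecOn with
  | nil => simp [potential_nil hk hd hb, value]
  | append_singleton σ r ih =>
    have hstep := mul_le_mul_of_nonneg_left
      (potential_concat_sub_le hk hd hw hA σ (hσ r (by simp))) hc0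
    have hreward : c * ((A.assign σ r).elim 0 fun s => w s / cStar k d (b s))
        ≤ (A.assign σ r).elim 0 w := by
      cases A.assign σ r with
      | none => simp
      | some s =>
        change c * (w s / _) ≤ w s
        rw [mul_div_left_comm]
        exact mul_le_of_le_one_right (hw s) (div_le_one_of_le₀ (hc s) (hc0.trans (hc s)))
    rw [value_run_concat]
    linarith [ih fun r hr => hσ r (by simp [hr])]

end Potential

theorem opt_le_sum [Fintype S] (b : S → ℕ) (hw : ∀ s, 0 ≤ w s) (σ : List (Finset S)) :
    opt b w σ ≤ ∑ s, w s * b s := by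
  obtain ⟨m, hm, hopt⟩ := (isGreatest_opt b w σ).1
  rw [← hopt, value_eq_sum_load]
  exact Finset.sum_le_sum fun s _ =>
    mul_le_mul_of_nonneg_left (by exact_mod_cast hm.2 s) (hw s)

theorem IsWeightedAssignmentVW.isCompetitive [Finite S] (hk : 1 ≤ k) (hd : 2 ≤ d)
    (hb : ∀ s, 1 ≤ b s) (hw : ∀ s, 0 ≤ w s) (hA : IsWeightedAssignmentVW k d w A)
    {c : ℝ} (hc0 : 0 ≤ c) (hc : ∀ s, c ≤ cStar k d (b s)) : IsCompetitive k d w A c := by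
  cases nonempty_fintype S
  intro σ hσ
  calc c * opt b w σ
    _ ≤ c * ∑ s, w s * b s := mul_le_mul_of_nonneg_left (opt_le_sum b hw σ) hc0
    _ = c * potential k d w A σ := by
      simp only [potential, serverPotential, V_of_degree _ _ _ _ _ (hσ.1 _), mul_one]
    _ ≤ value w (run A.assign σ) := mul_potential_le_value hk hd hb hw hA hc0 hc hσ.2

end Competitive

section Opt

variable {S : Type*} [DecidableEq S] {k d : ℕ} {b : S → ℕ} {σ : List (Finset S)}

theorem exists_isBMatching_load_eq_of_injective {f : (Σ s, Fin (b s)) → Fin σ.length}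
    (hf : f.Injective) (hadj : ∀ x, x.1 ∈ σ.get (f x)) :
    ∃ m, IsBMatching b σ m ∧ ∀ s, load m s = b s := by
  let m (i : Fin σ.length) : Option S := (Function.partialInv f i).map Sigma.fst
  have hm (i : Fin σ.length) (s : S) : m i = some s ↔ ∃ j, f ⟨s, j⟩ = i := by
    simp only [m, Option.map_eq_some_iff]
    constructor
    · rintro ⟨⟨s, j⟩, hinv, rfl⟩
      exact ⟨j, (hf.isPartialInv _ _).1 hinv⟩
    · rintro ⟨j, hj⟩
      exact ⟨⟨s, j⟩, (hf.isPartialInv _ _).2 hj, rfl⟩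
  have hload (s : S) : load m s = b s := by
    have himage : Finset.univ.filter (fun i => m i = some s)
        = Finset.univ.image (f ∘ Sigma.mk s) := by
      ext i
      simp [hm]
    rw [load, himage, Finset.card_image_of_injective _ (hf.comp sigma_mk_injective),
      Finset.card_univ, Fintype.card_fin]
  refine ⟨m, ⟨fun i s hi => ?_, fun s => (hload s).le⟩, hload⟩
  obtain ⟨j, rfl⟩ := (hm i s).1 hi
  exact hadj ⟨s, j⟩

theorem exists_isBMatching_load_eq_of_hall
    (hall : ∀ Y : Finset S,
      ∑ s ∈ Y, b s ≤ (Finset.univ.filter fun i => ∃ s ∈ Y, s ∈ σ.get i).card) :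
    ∃ m, IsBMatching b σ m ∧ ∀ s, load m s = b s := by
  let nbrs (x : Σ s, Fin (b s)) : Finset (Fin σ.length) :=
    Finset.univ.filter fun i => x.1 ∈ σ.get i
  have hcopies (X : Finset (Σ s, Fin (b s))) : X.card ≤ (X.biUnion nbrs).card := by
    calc X.card
      _ ≤ ((X.image Sigma.fst).sigma fun s => (Finset.univ : Finset (Fin (b s)))).card :=
        Finset.card_le_card fun x hx =>
          Finset.mem_sigma.2 ⟨Finset.mem_image_of_mem _ hx, Finset.mem_univ _⟩
      _ = ∑ s ∈ X.image Sigma.fst, b s := by simp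
      _ ≤ _ := hall _
      _ = (X.biUnion nbrs).card := by
        congr 1
        ext i
        simp [nbrs]
  obtain ⟨f, hf, hnbrs⟩ :=
    (Finset.all_card_le_biUnion_card_iff_exists_injective nbrs).1 hcopies
  exact exists_isBMatching_load_eq_of_injective hf fun x => (Finset.mem_filter.1 (hnbrs x)).2

theorem IsKDGraph.sum_le_card (hσ : IsKDGraph k d b σ) (hd : 1 ≤ d) (hkd : d ≤ k)
    (Y : Finset S) :
    ∑ s ∈ Y, b s ≤ (Finset.univ.filter fun i => ∃ s ∈ Y, s ∈ σ.get i).card := by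
  set N := Finset.univ.filter fun i => ∃ s ∈ Y, s ∈ σ.get i with hN
  refine Nat.le_of_mul_le_mul_right (c := d) ?_ hd
  calc (∑ s ∈ Y, b s) * d
    _ ≤ ∑ s ∈ Y, degree σ s := by
      rw [Finset.sum_mul]
      exact Finset.sum_le_sum fun s _ =>
        (Nat.mul_comm _ _).trans_le ((Nat.mul_le_mul_right _ hkd).trans (hσ.1 s))
    _ = ∑ s ∈ Y, (N.filter fun i => s ∈ σ.get i).card := by
      refine Finset.sum_congr rfl fun s hs => ?_
      rw [degree_eq_card, hN, Finset.filter_filter]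
      congr 1
      ext i
      simp only [Finset.mem_filter, Finset.mem_univ, true_and]
      exact ⟨fun hi => ⟨⟨s, hs, hi⟩, hi⟩, And.right⟩
    _ = ∑ i ∈ N, (Y.filter fun s => s ∈ σ.get i).card :=
      Finset.sum_card_bipartiteAbove_eq_sum_card_bipartiteBelow _
    _ ≤ N.card * d := Finset.sum_le_card_nsmul _ _ _ fun i _ =>
      (Finset.card_le_card fun s hs => (Finset.mem_filter.1 hs).2).trans (hσ.2 _ (σ.get_mem i))

theorem IsKDGraph.sum_le_opt [Fintype S] (hσ : IsKDGraph k d b σ) (hd : 1 ≤ d) (hkd : d ≤ k)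
    (w : S → ℝ) : ∑ s, w s * b s ≤ opt b w σ := by
  obtain ⟨m, hm, hload⟩ := exists_isBMatching_load_eq_of_hall (hσ.sum_le_card hd hkd)
  refine (isGreatest_opt b w σ).2 ⟨m, hm, ?_⟩
  simp only [value_eq_sum_load, hload]

end Opt

section Adversary

variable {S : Type*} [DecidableEq S] {d i j : ℕ} {U W : Finset S} {σ τ : List (Finset S)}

/-- The requests `τ` form a bipartite graph on the servers `U` in which every request has degree
`d` and every server of `U` has degree `j`. -/
def IsBiregularOn (d j : ℕ) (U : Finset S) (τ : List (Finset S)) : Prop :=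
  (∀ r ∈ τ, r ⊆ U ∧ r.card = d) ∧ ∀ s ∈ U, degree τ s = j

namespace IsBiregularOn

theorem degree_eq_zero (hτ : IsBiregularOn d j U τ) {s : S} (hs : s ∉ U) : degree τ s = 0 :=
  degree_eq_zero_iff.2 fun r hr hsr => hs ((hτ.1 r hr).1 hsr)

theorem append (hσ : IsBiregularOn d i U σ) (hτ : IsBiregularOn d j U τ) :
    IsBiregularOn d (i + j) U (σ ++ τ) :=
  ⟨fun r hr => (List.mem_append.1 hr).elim (hσ.1 r) (hτ.1 r),
    fun s hs => by rw [degree_append, hσ.2 s hs, hτ.2 s hs]⟩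

theorem append_sdiff (hσ : IsBiregularOn d j W σ) (hτ : IsBiregularOn d j (U \ W) τ)
    (hWU : W ⊆ U) : IsBiregularOn d j U (σ ++ τ) := by
  refine ⟨fun r hr => ?_, fun s hs => ?_⟩
  · rcases List.mem_append.1 hr with hr | hr
    · exact ⟨(hσ.1 r hr).1.trans hWU, (hσ.1 r hr).2⟩
    · exact ⟨(hτ.1 r hr).1.trans Finset.sdiff_subset, (hτ.1 r hr).2⟩
  · rw [degree_append]
    by_cases hsW : s ∈ W
    · rw [hσ.2 s hsW, hτ.degree_eq_zero (by simp [hsW]), add_zero]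
    · rw [hσ.degree_eq_zero hsW, hτ.2 s (Finset.mem_sdiff.2 ⟨hs, hsW⟩), zero_add]

end IsBiregularOn

theorem exists_isBiregularOn_one (hU : d ∣ U.card) :
    ∃ τ, IsBiregularOn d 1 U τ ∧ d * τ.length = U.card := by
  obtain ⟨q, hq⟩ := hU
  induction q generalizing U with
  | zero =>
    obtain rfl : U = ∅ := Finset.card_eq_zero.1 hq
    exact ⟨[], ⟨by simp, by simp⟩, by simp⟩
  | succ q ih =>
    rw [Nat.mul_succ] at hq
    obtain ⟨r, hrU, hr⟩ := Finset.exists_subset_card_eq (n := d) (s := U) (by omega)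
    have hcard : (U \ r).card = d * q := by
      rw [Finset.card_sdiff_of_subset hrU, hq, hr, Nat.add_sub_cancel]
    obtain ⟨τ, hτ, hlen⟩ := ih hcard
    have hsingle : IsBiregularOn d 1 r [r] :=
      ⟨by simp [hr], fun s hs => by rw [degree_singleton, if_pos hs]⟩
    refine ⟨[r] ++ τ, hsingle.append_sdiff hτ hrU, ?_⟩
    rw [List.length_append, List.length_singleton, Nat.mul_add, hlen, hcard, hq]
    ring

theorem card_filter_load_run_lt_le_length
    (assign : List (Finset S) → Finset S → Option S) (U : Finset S) (σ τ : List (Finset S)) :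
    (U.filter fun s => load (run assign σ) s < load (run assign (σ ++ τ)) s).card
      ≤ τ.length := by
  induction τ using List.reverseRecOn with
  | nil =>
    rw [List.append_nil]
    simp
  | append_singleton τ r ih =>
    have hsub : U.filter (fun s => load (run assign σ) s < load (run assign (σ ++ (τ ++ [r]))) s)
        ⊆ U.filter (fun s => load (run assign σ) s < load (run assign (σ ++ τ)) s)
          ∪ (assign (σ ++ τ) r).toFinset := by
      intro s hs
      rw [Finset.mem_filter, ← List.append_assoc, load_run_concat] at hs
      rw [Finset.mem_union, Finset.mem_filter, Option.mem_toFinset, Option.mem_def]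
      split_ifs at hs with hassign
      · exact Or.inr hassign
      · exact Or.inl hs
    calc _
      _ ≤ _ := (Finset.card_le_card hsub).trans (Finset.card_union_le _ _)
      _ ≤ τ.length + 1 := Nat.add_le_add ih (by cases assign (σ ++ τ) r <;> simp)
      _ = (τ ++ [r]).length := by simp

variable {b : S → ℕ} (A : OnlineAlgorithm b)

theorem IsBiregularOn.load_append_le (hτ : IsBiregularOn d j U τ) (σ : List (Finset S)) {s : S}
    (hs : s ∈ U) : load (run A.assign (σ ++ τ)) s ≤ load (run A.assign σ) s + j :=
  hτ.2 s hs ▸ A.load_append_le σ τ s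

theorem IsBiregularOn.load_append_le_of_notMem (hτ : IsBiregularOn d j U τ)
    (σ : List (Finset S)) {s : S} (hs : s ∉ U) :
    load (run A.assign (σ ++ τ)) s ≤ load (run A.assign σ) s := by
  have hload := A.load_append_le σ τ s
  rwa [hτ.degree_eq_zero hs] at hload

/-- A request of degree `d` increases the load of at most one of its neighbours, so requests that
partition `U` leave all but a fraction `1 / d` of the loads in `U` unchanged. -/
theorem exists_isBiregularOn_one_load_le (hd : 1 ≤ d) (hU : d ∣ U.card) (σ : List (Finset S)) :
    ∃ τ, IsBiregularOn d 1 U τ ∧ ∃ W ⊆ U, d * W.card = U.card ∧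
      ∀ s ∈ U \ W, load (run A.assign (σ ++ τ)) s ≤ load (run A.assign σ) s := by
  obtain ⟨τ, hτ, hlen⟩ := exists_isBiregularOn_one hU
  obtain ⟨W, hW, hWU, hcard⟩ := Finset.exists_subsuperset_card_eq (Finset.filter_subset _ U)
    (card_filter_load_run_lt_le_length A.assign U σ τ) (hlen ▸ Nat.le_mul_of_pos_left _ hd)
  refine ⟨τ, hτ, W, hWU, by rw [hcard, hlen], fun s hs => not_lt.1 fun hlt => ?_⟩
  obtain ⟨hsU, hsW⟩ := Finset.mem_sdiff.1 hs
  exact hsW (hW (Finset.mem_filter.2 ⟨hsU, hlt⟩))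

/-- After one round the adversary recurses separately on the servers that may have been served and
on the others, as if each server of `U` had been served with probability `1 / d`. -/
theorem exists_isBiregularOn_sum_load_le (hd : 1 ≤ d) {β : ℕ} (hb : ∀ s ∈ U, b s ≤ β)
    (hU : d ^ j ∣ U.card) {l : ℕ} (hl : ∀ s ∈ U, load (run A.assign σ) s ≤ l) :
    ∃ τ, IsBiregularOn d j U τ ∧ ∑ s ∈ U, (load (run A.assign (σ ++ τ)) s : ℝ)
      ≤ U.card * ∫ x, min (β : ℝ) (l + x) ∂Bin(j, uniformProb d) := by
  induction j generalizing l U σ with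
  | zero =>
    refine ⟨[], ⟨by simp, by simp [degree_nil]⟩, ?_⟩
    rw [List.append_nil, binomial_zero, integral_dirac, Nat.cast_zero, add_zero, ← nsmul_eq_mul]
    exact Finset.sum_le_card_nsmul _ _ _ fun s hs => le_min
      (by exact_mod_cast (A.load_le σ s).trans (hb s hs)) (by exact_mod_cast hl s hs)
  | succ j ih =>
    obtain ⟨τ₀, hτ₀, W, hWU, hW, hunchanged⟩ :=
      exists_isBiregularOn_one_load_le A hd ((dvd_pow_self d j.succ_ne_zero).trans hU) σ
    have hWdvd : d ^ j ∣ W.card := by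
      rwa [← hW, pow_succ', Nat.mul_dvd_mul_iff_left hd] at hU
    have hLdvd : d ^ j ∣ (U \ W).card := by
      rw [Finset.card_sdiff_of_subset hWU, ← hW]
      exact Nat.dvd_sub (hWdvd.mul_left d) hWdvd
    obtain ⟨τ₁, hτ₁, hsum₁⟩ := ih (σ := σ ++ τ₀) (l := l + 1) (fun s hs => hb s (hWU hs)) hWdvd
      fun s hs => (hτ₀.load_append_le A σ (hWU hs)).trans (Nat.succ_le_succ (hl s (hWU hs)))
    obtain ⟨τ₂, hτ₂, hsum₂⟩ := ih (σ := σ ++ τ₀ ++ τ₁) (l := l)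
      (fun s hs => hb s (Finset.mem_sdiff.1 hs).1) hLdvd fun s hs =>
        (hτ₁.load_append_le_of_notMem A _ (Finset.mem_sdiff.1 hs).2).trans
          ((hunchanged s hs).trans (hl s (Finset.mem_sdiff.1 hs).1))
    refine ⟨τ₀ ++ (τ₁ ++ τ₂), add_comm 1 j ▸ hτ₀.append (hτ₁.append_sdiff hτ₂ hWU), ?_⟩
    rw [← Finset.sum_sdiff hWU, ← List.append_assoc, ← List.append_assoc]
    have hsumW : ∑ s ∈ W, (load (run A.assign (σ ++ τ₀ ++ τ₁ ++ τ₂)) s : ℝ)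
        ≤ ∑ s ∈ W, (load (run A.assign (σ ++ τ₀ ++ τ₁)) s : ℝ) :=
      Finset.sum_le_sum fun s hs => Nat.cast_le.2
        (hτ₂.load_append_le_of_notMem A _ fun h => (Finset.mem_sdiff.1 h).2 hs)
    refine (add_le_add hsum₂ (hsumW.trans hsum₁)).trans (le_of_eq ?_)
    have hdW : (d : ℝ) * W.card = U.card := by exact_mod_cast hW
    have hd0 : (d : ℝ) ≠ 0 := by positivity
    rw [Finset.cast_card_sdiff hWU, integral_binomial_succ, coe_uniformProb, ← hdW]
    push_cast
    simp only [add_assoc, add_comm (1 : ℝ), smul_eq_mul]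
    field_simp
    ring

end Adversary

section Optimality

variable {k d : ℕ}

theorem degree_flatMap_replicate {S : Type*} [DecidableEq S] (T : List S) (n : S → ℕ) (s : S) :
    degree (T.flatMap fun t => List.replicate (n t) {t}) s = T.count s * n s := by
  induction T with
  | nil => simp [degree_nil]
  | cons t T ih =>
    rw [List.flatMap_cons, degree_append, ih, List.count_cons]
    by_cases h : t = s
    · subst h
      simp [degree, List.countP_replicate, Nat.add_mul, Nat.add_comm]
    · simp [degree, List.countP_replicate, h, Ne.symm h]

section Copies

variable {S : Type*} [DecidableEq S] {b : S → ℕ} {w : S → ℝ} {U : Finset S}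

theorem exists_isKDGraph_append [Finite S] (k : ℕ) (hd : 1 ≤ d) {τ : List (Finset S)}
    (hdeg : ∀ s ∈ U, k * b s ≤ degree τ s) (hcard : ∀ r ∈ τ, r.card ≤ d) :
    ∃ ρ, (∀ s ∈ U, degree ρ s = 0) ∧ IsKDGraph k d b (τ ++ ρ) := by
  cases nonempty_fintype S
  let ρ := Uᶜ.toList.flatMap fun t => List.replicate (k * b t) ({t} : Finset S)
  have hρ (s : S) : degree ρ s = Uᶜ.toList.count s * (k * b s) := degree_flatMap_replicate ..
  refine ⟨ρ, fun s hs => ?_, fun s => ?_, fun r hr => ?_⟩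
  · rw [hρ, List.count_eq_zero_of_not_mem (by simpa using hs), zero_mul]
  · rw [degree_append]
    by_cases hs : s ∈ U
    · exact (hdeg s hs).trans (Nat.le_add_right _ _)
    · rw [hρ, List.count_eq_one_of_mem (Finset.nodup_toList _) (by simpa using hs), one_mul]
      exact Nat.le_add_left _ _
  · rcases List.mem_append.1 hr with hr | hr
    · exact hcard r hr
    · obtain ⟨t, -, ht⟩ := List.mem_flatMap.1 hr
      rw [List.eq_of_mem_replicate ht, Finset.card_singleton]
      exact hd

theorem exists_isKDGraph_sum_load_le [Finite S] (A : OnlineAlgorithm b) (hd : 2 ≤ d)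
    {β : ℕ} (hU : d ^ (k * β) ∣ U.card) (hb : ∀ s ∈ U, b s = β) :
    ∃ σ, IsKDGraph k d b σ ∧
      ∑ s ∈ U, (load (run A.assign σ) s : ℝ) ≤ U.card * (β * cStar k d β) := by
  obtain ⟨τ, hτ, hsum⟩ := exists_isBiregularOn_sum_load_le A (σ := []) (l := 0) (by omega)
    (fun s hs => (hb s hs).le) hU fun s _ => (load_run_nil A.assign s).le
  obtain ⟨ρ, hρ, hKD⟩ := exists_isKDGraph_append (b := b) k (by omega)
    (fun s hs => by rw [hτ.2 s hs, hb s hs]) fun r hr => (hτ.1 r hr).2.le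
  refine ⟨τ ++ ρ, hKD, ?_⟩
  simp only [List.nil_append, Nat.cast_zero, zero_add, ← mul_cStar k β hd] at hsum
  refine le_trans (Finset.sum_le_sum fun s hs => ?_) hsum
  have hload := A.load_append_le τ ρ s
  rw [hρ s hs] at hload
  exact_mod_cast hload

theorem IsCompetitive.sub_mul_le [Fintype S] {A : OnlineAlgorithm b} {c : ℝ}
    (hA : IsCompetitive k d w A c) (hc : 0 ≤ c) (hd : 2 ≤ d) (hkd : d ≤ k) (hw : ∀ s, 0 ≤ w s)
    {β : ℕ} {ω : ℝ} (hω : 0 ≤ ω) (hU : d ^ (k * β) ∣ U.card) (hb : ∀ s ∈ U, b s = β)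
    (hwU : ∀ s ∈ U, w s = ω) :
    (c - cStar k d β) * (U.card * ω * β) ≤ ∑ s ∈ Uᶜ, w s * b s := by
  obtain ⟨σ, hσ, hsum⟩ := exists_isKDGraph_sum_load_le A hd hU hb
  have hopt : U.card * ω * β ≤ opt b w σ := by
    refine le_trans ?_ ((Finset.sum_le_univ_sum_of_nonneg (s := U) fun s =>
      mul_nonneg (hw s) (b s).cast_nonneg).trans (hσ.sum_le_opt (by omega) hkd w))
    rw [Finset.sum_congr rfl fun s hs => by rw [hb s hs, hwU s hs], Finset.sum_const,
      nsmul_eq_mul, mul_assoc]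
  have hvalueU : ∑ s ∈ U, w s * load (run A.assign σ) s ≤ ω * (U.card * (β * cStar k d β)) := by
    rw [Finset.sum_congr rfl fun s hs => by rw [hwU s hs], ← Finset.mul_sum]
    exact mul_le_mul_of_nonneg_left hsum hω
  have hvalueUc : ∑ s ∈ Uᶜ, w s * load (run A.assign σ) s ≤ ∑ s ∈ Uᶜ, w s * b s :=
    Finset.sum_le_sum fun s _ =>
      mul_le_mul_of_nonneg_left (by exact_mod_cast A.load_le σ s) (hw s)
  have hcomp := (mul_le_mul_of_nonneg_left hopt hc).trans (hA σ hσ)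
  rw [value_eq_sum_load, ← Finset.sum_add_sum_compl U] at hcomp
  linarith

end Copies

theorem exists_fin_range_eq_of_mem {α : Type*} {T : Finset α} {a : α} (ha : a ∈ T) (N : ℕ) :
    ∃ (n : ℕ) (p : Fin n → α) (U : Finset (Fin n)), Set.range p = T ∧ U.card = N ∧
      (∀ s ∈ U, p s = a) ∧ ∀ g : α → ℝ, ∑ s ∈ Uᶜ, g (p s) = ∑ t ∈ T, g t := by
  let p : Fin (N + T.card) → α := Fin.append (fun _ => a) fun i => T.equivFin.symm i
  let U : Finset (Fin (N + T.card)) := Finset.univ.map (Fin.castAddEmb T.card)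
  have hcompl : Uᶜ = Finset.univ.map (Fin.natAddEmb N) := by
    ext s
    cases s using Fin.addCases <;> simp [U, Fin.ext_iff] <;> omega
  have hpT (s) : p s ∈ T := by
    cases s using Fin.addCases <;> simp [p, ha]
  refine ⟨_, p, U, Set.Subset.antisymm (Set.range_subset_iff.2 hpT) fun t ht => ?_, by simp [U],
    by simp [U, p], fun g => ?_⟩
  · exact ⟨Fin.natAdd N (T.equivFin ⟨t, ht⟩), by simp [p]⟩
  · rw [hcompl, Finset.sum_map]
    simp only [p, Fin.natAddEmb_apply, Fin.append_right]
    rw [T.equivFin.symm.sum_comp fun t => g t, Finset.sum_coe_sort T g]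

theorem le_cStar_of_forall_isCompetitive (hk : 1 ≤ k) (hd : 2 ≤ d) (hkd : d ≤ k)
    {T : Finset (ℕ × ℝ)} (hT : ∀ t ∈ T, 0 ≤ t.2)
    (A : ∀ (n : ℕ) (b : Fin n → ℕ), (Fin n → ℝ) → OnlineAlgorithm b) {c : ℝ}
    (hA : ∀ (n : ℕ) (b : Fin n → ℕ) (w : Fin n → ℝ),
      Set.range (fun s => (b s, w s)) = (T : Set (ℕ × ℝ)) → IsCompetitive k d w (A n b w) c)
    {t₀ : ℕ × ℝ} (ht₀ : t₀ ∈ T) (hb₀ : 1 ≤ t₀.1) (hw₀ : 0 < t₀.2) :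
    c ≤ cStar k d t₀.1 := by
  rcases lt_or_ge c 0 with hc | hc
  · exact hc.le.trans (cStar_pos hk hd hb₀).le
  by_contra! hlt
  have hgain : 0 < (c - cStar k d t₀.1) * ((d ^ (k * t₀.1) : ℕ) * t₀.2 * t₀.1) :=
    mul_pos (sub_pos.2 hlt) (mul_pos (mul_pos (Nat.cast_pos.2 (pow_pos (by omega) _)) hw₀)
      (Nat.cast_pos.2 hb₀))
  obtain ⟨q, hq⟩ := exists_lt_nsmul hgain (∑ t ∈ T, t.2 * t.1)
  obtain ⟨n, p, U, hrange, hUcard, hpU, hUc⟩ :=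
    exists_fin_range_eq_of_mem ht₀ (q * d ^ (k * t₀.1))
  have hpT (s : Fin n) : p s ∈ T := Finset.mem_coe.1 (hrange ▸ Set.mem_range_self s)
  have hbound := (hA n (fun s => (p s).1) (fun s => (p s).2) hrange).sub_mul_le hc hd hkd
    (fun s => hT _ (hpT s)) hw₀.le (hUcard ▸ Nat.dvd_mul_left _ q)
    (fun s hs => by rw [hpU s hs]) fun s hs => by rw [hpU s hs]
  rw [hUc fun t => t.2 * t.1, hUcard] at hbound
  rw [nsmul_eq_mul] at hq
  push_cast at hbound hq
  linarith

end Optimality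

end OnlineBMatching

open OnlineBMatching in
theorem mainTheorem5_general.{u} (k d : ℕ) (hk : 1 ≤ k) (hd : 2 ≤ d) :
    (∀ (S : Type u) [Fintype S] [Nonempty S] [DecidableEq S] (b : S → ℕ) (w : S → ℝ),
      (∀ s, 1 ≤ b s) → (∀ s, 0 ≤ w s) →
      (∃ A : OnlineAlgorithm b, IsWeightedAssignmentVW k d w A) ∧
      ∀ A : OnlineAlgorithm b, IsWeightedAssignmentVW k d w A →
        IsCompetitive k d w A
          (Finset.univ.inf' Finset.univ_nonempty fun s => cStar k d (b s))) ∧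
    (∀ (S : Type u) [Fintype S] [Nonempty S] (b : S → ℕ), (∀ s, 1 ≤ b s) →
      Finset.univ.inf' Finset.univ_nonempty (fun s => cStar k d (b s))
        = cStar k d (Finset.univ.inf' Finset.univ_nonempty b)) ∧
    (d ≤ k → ∀ (T : Finset (ℕ × ℝ)) (hT : T.Nonempty), (∀ t ∈ T, 1 ≤ t.1 ∧ 0 < t.2) →
      ∀ (A : ∀ (n : ℕ) (b : Fin n → ℕ), (Fin n → ℝ) → OnlineAlgorithm b) (c : ℝ),
        (∀ (n : ℕ) (b : Fin n → ℕ) (w : Fin n → ℝ),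
          Set.range (fun s => (b s, w s)) = (T : Set (ℕ × ℝ)) → IsCompetitive k d w (A n b w) c) →
        c ≤ cStar k d (T.inf' hT Prod.fst)) := by
  refine ⟨fun S _ _ _ b w hb hw => ⟨exists_isWeightedAssignmentVW k d b w, fun A hA => ?_⟩,
    fun S _ _ b hb => inf'_cStar hk hd _ fun s _ => hb s, fun hkd T hT hpos A c hA => ?_⟩
  · exact hA.isCompetitive hk hd hb hw
      (Finset.le_inf' _ _ fun s _ => (cStar_pos hk hd (hb s)).le)
      fun s => Finset.inf'_le _ (Finset.mem_univ s)
  · obtain ⟨t, ht, hmin⟩ := T.exists_mem_eq_inf' hT Prod.fst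
    rw [hmin]
    exact le_cStar_of_forall_isCompetitive hk hd hkd (fun t ht => (hpos t ht).2.le) A hA ht
      (hpos t ht).1 (hpos t ht).2

theorem mainTheorem5 (k d : ℕ) (hk : 1 ≤ k) (hd : 2 ≤ d) :
    -- WeightedAssignment(VW) exists and is `min_s c*_s`-competitive, however ties are broken
    (∀ (n : ℕ) [NeZero n] (b : Fin n → ℕ) (w : Fin n → ℝ), (∀ s, 1 ≤ b s) → (∀ s, 0 ≤ w s) →
      (∃ A : OnlineBMatching.OnlineAlgorithm b, OnlineBMatching.IsWeightedAssignmentVW k d w A) ∧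
      ∀ A : OnlineBMatching.OnlineAlgorithm b, OnlineBMatching.IsWeightedAssignmentVW k d w A →
        OnlineBMatching.IsCompetitive k d w A
          (Finset.univ.inf' Finset.univ_nonempty
            (fun s => OnlineBMatching.cStar k d (b s)))) ∧
    -- for `k ≥ d` this ratio is `c*` for the smallest capacity
    (d ≤ k → ∀ (n : ℕ) [NeZero n] (b : Fin n → ℕ), (∀ s, 1 ≤ b s) →
      Finset.univ.inf' Finset.univ_nonempty (fun s => OnlineBMatching.cStar k d (b s))
        = OnlineBMatching.cStar k d (Finset.univ.inf' Finset.univ_nonempty b)) ∧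
    -- for `k ≥ d` no deterministic online algorithm has a larger ratio, for any prescribed
    -- finite set `T` of pairs (capacity, weight) of the servers
    (d ≤ k → ∀ (T : Finset (ℕ × ℝ)) (hT : T.Nonempty), (∀ t ∈ T, 1 ≤ t.1 ∧ 0 < t.2) →
      ∀ (A : ∀ (n : ℕ) (b : Fin n → ℕ), (Fin n → ℝ) → OnlineBMatching.OnlineAlgorithm b) (c : ℝ),
        (∀ (n : ℕ) (b : Fin n → ℕ) (w : Fin n → ℝ),
          Set.range (fun s => (b s, w s)) = (T : Set (ℕ × ℝ)) →
          OnlineBMatching.IsCompetitive k d w (A n b w) c) →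
        c ≤ OnlineBMatching.cStar k d (T.inf' hT Prod.fst)) := by
  obtain ⟨hratio, hmin, hoptimal⟩ := mainTheorem5_general k d hk hd
  exact ⟨fun n _ => hratio (Fin n), fun _ n _ => hmin (Fin n), hoptimal⟩
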